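/- For real $x\le 1$ let $\mathcal L(x)=\mathrm{Li}_2(x)+\tfrac12\log|x|\log(1-x)$ be the (extended) Rogers dilogarithm, where $\mathrm{Li}_2(x)=-\int_0^x\frac{\log(1-t)}{t}\,dt$ (and $\mathcal L(0)=0$, $\mathcal L(1)=\mathrm{Li}_2(1)$). Let $n\ge 3$ be an integer and let the regular ideal $n$-gon in the Poincaré disk have vertices $v_k=e^{2\pi i k/n}$ and sides $s_k$, where $s_k$ is the geodesic from $v_k$ to $v_{k+1}$ (indices mod $n$). (1) Let $0\le i<j\le n-1$ be such that $s_i$ and $s_j$ have no common ideal endpoint. Then the hyperbolic distance $l_{ij}$ between $s_i$ and $s_j$ is positive and attained, and, with $[z_1,z_2,z_3,z_4]=\frac{(z_1-z_2)(z_4-z_3)}{(z_1-z_3)(z_4-z_2)}$, $$[v_i,v_{i+1},v_j,v_{j+1}]=\frac1{\cosh^2(l_{ij}/2)}=\frac{\sin^2(\pi/n)}{\sin^2((j-i)\pi/n)} .$$ (2) With $e_n=1$ for even $n$ and $e_n=0$ for odd $n$, and the first sum running over all pairs $(i,j)$ as in (1), $$\sum_{(i,j)}\mathcal L\Big(\frac1{\cosh^2(l_{ij}/2)}\Big)=\sum_{r=2}^{\lceil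 n/2\rceil-1} n\,\mathcal L\Big(\frac{\sin^2(\pi/n)}{\sin^2(r\pi/n)}\Big)+e_n\,\frac n2\,\mathcal L\big(\sin^2(\pi/n)\big)=\frac{(n-3)\pi^2}{6}.$$ (3) With $\phi=\frac{1+\sqrt5}2$, one has Landen's values $\mathcal L(\phi^{-1})=\frac{\pi^2}{10}$, $\mathcal L(1-\phi^{-1})=\mathcal L(\phi^{-2})=\frac{\pi^2}{15}$, $\mathcal L(-\phi^{-1})=-\frac{\pi^2}{15}$, $\mathcal L(-\phi)=-\frac{\pi^2}{10}$, and the hexagon relation $6\,\mathcal L(\tfrac13)+3\,\mathcal L(\tfrac14)=\frac{\pi^2}{2}$. -/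

import Mathlib

/-- The dilogarithm on the real half-line `x ≤ 1`, `Li₂(x) = -∫₀ˣ log(1-t)/t dt`. -/
noncomputable def dilog (x : ℝ) : ℝ :=
  -∫ t in (0 : ℝ)..x, Real.log (1 - t) / t

/-- The (extended) Rogers dilogarithm, considered for `x ≤ 1`.
The convention `Real.log 0 = 0` gives the continuous values at `x = 0` and `x = 1`. -/
noncomputable def rogersL (x : ℝ) : ℝ :=
  dilog x + (1 / 2) * Real.log |x| * Real.log (1 - x)

/-- The cross-ratio `[z₁, z₂, z₃, z₄] = (z₁-z₂)(z₄-z₃) / ((z₁-z₃)(z₄-z₂))`. -/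
noncomputable def crossRatio (z₁ z₂ z₃ z₄ : ℂ) : ℂ :=
  ((z₁ - z₂) * (z₄ - z₃)) / ((z₁ - z₃) * (z₄ - z₂))

/-- Hyperbolic distance (curvature `-1`) between two points of the Poincaré disk:
`sinh² (d/2) = |z-w|² / ((1-|z|²)(1-|w|²))`. -/
noncomputable def diskDist (z w : ℂ) : ℝ :=
  2 * Real.arsinh (‖z - w‖ / Real.sqrt ((1 - ‖z‖ ^ 2) * (1 - ‖w‖ ^ 2)))

/-- The geodesic of the Poincaré disk with distinct ideal endpoints `a`, `b` on the unit circle.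
The Möbius map `z ↦ (z-a)/(z-b)` sends `a, b` to `0, ∞` and the unit circle to the line
through `0` whose points have square in `ℝ≥0 * (a/b)`; the geodesic is sent to the ray from `0`
perpendicular to it, whose points have square in `-ℝ>0 * (a/b)`. -/
def diskGeodesic (a b : ℂ) : Set ℂ :=
  {z | ‖z‖ < 1 ∧ ∃ t : ℝ, 0 < t ∧ b * (z - a) ^ 2 = -(t : ℂ) * (a * (z - b) ^ 2)}

/-- Vertices `v_k = exp(2πi k/n)` of the regular ideal `n`-gon centred at `0`. -/
noncomputable def vertex (n k : ℕ) : ℂ :=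
  Complex.exp (2 * Real.pi * Complex.I * k / n)

/-- The side `s_k` of the regular ideal `n`-gon, joining `v_k` to `v_{k+1}`. -/
def side (n k : ℕ) : Set ℂ :=
  diskGeodesic (vertex n k) (vertex n (k + 1))

/-- All hyperbolic distances from a point of `s_i` to a point of `s_j`. -/
def sideDistances (n i j : ℕ) : Set ℝ :=
  {d | ∃ z ∈ side n i, ∃ w ∈ side n j, d = diskDist z w}

/-- The distance between `s_i` and `s_j`; for sides without a common ideal endpoint this is the
length of their common perpendicular. -/
noncomputable def orthoLength (n i j : ℕ) : ℝ :=
  sInf (sideDistances n i j)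

/-- The pairs `i < j` in `{0, …, n-1}` for which `s_i`, `s_j` have no common ideal endpoint,
that is, they are not cyclically adjacent. These index the orthospectrum. -/
def disjointSidePairs (n : ℕ) : Finset (ℕ × ℕ) :=
  (Finset.range n ×ˢ Finset.range n).filter
    (fun p => p.1 + 2 ≤ p.2 ∧ p.2 + 2 ≤ p.1 + n)

/-- The left-hand side of the regular ideal `n`-gon relation. -/
noncomputable def regularPolygonSum (n : ℕ) : ℝ :=
  (∑ r ∈ Finset.Icc 2 (⌈(n : ℝ) / 2⌉₊ - 1),
    (n : ℝ) * rogersL (Real.sin (Real.pi / n) ^ 2 / Real.sin (r * Real.pi / n) ^ 2))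
  + (if Even n then (1 : ℝ) else 0) * ((n : ℝ) / 2) * rogersL (Real.sin (Real.pi / n) ^ 2)

/-!
The relation rests on three facts about the Rogers dilogarithm, all obtained from its differential
`dL(u) = ½ (log |u| dlog (1 - u) - log (1 - u) dlog |u|)` and continuity up to the endpoints:
Euler's reflection `L(x) + L(1 - x) = π² / 6` (whose constant is `L(1) = ζ(2)`), Landen's
transformation of the negative axis, and Abel's five-term relation `rogersL_add_rogersL`.

Applied to cross-ratios of points on a circle, Abel's relation is a relation for an ideal pentagon,
`rogersL_sin_pentagon`. Cut the regular polygon into a fan of triangles from the vertex `v₀` and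
consider the polygons with vertices `v₀, …, v_k`. When `v_{k+1}` is added, each old side `s_i`
meets the two new sides instead of the old closing chord, and the pentagon relation says that its
contribution changes by a difference `G(i + 1) - G(i)`. These differences telescope, and the
boundary terms combine by Euler's reflection, so that every new vertex adds exactly `π² / 6`
(`rogersL_fan_sum`). The last polygon of the fan is regular, and its closing chord is one more
side.

For the geometry, `diskGeodesic_eq_range` parametrizes a geodesic by arc length. In arc lengths
`s`, `s'` on two sides, `sinh² (d / 2)` is a constant plus positive multiples of `cosh (s + s')` and
`cosh (s - s' - p₀)`, so the distance is attained where both equal `1`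
(`isLeast_diskDist_geodesicPoint`).

The golden-ratio values are the pentagon case `5 L(φ⁻²) = π² / 3` followed by reflection and Landen's
transformation; the last identity is the hexagon case.
-/

/-! ### The Rogers dilogarithm -/

open Set Filter Topology in
theorem continuousOn_dslope_log_one_sub :
    ContinuousOn (dslope (fun t : ℝ => Real.log (1 - t)) 0) (Iio 1) := by
  rw [continuousOn_dslope (Iio_mem_nhds one_pos)]
  refine ⟨?_, ?_⟩
  · intro t ht
    have : (1 : ℝ) - t ≠ 0 := by have := mem_Iio.1 ht; linarith
    exact ContinuousAt.continuousWithinAt (by fun_prop (disch := assumption))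
  · have : (1 : ℝ) - 0 ≠ 0 := by norm_num
    fun_prop (disch := assumption)

theorem dslope_log_one_sub_of_ne {t : ℝ} (ht : t ≠ 0) :
    dslope (fun t : ℝ => Real.log (1 - t)) 0 t = Real.log (1 - t) / t := by
  rw [dslope_of_ne _ ht, slope_def_field]; simp

open MeasureTheory Set in
theorem intervalIntegrable_log_one_sub_div {a b : ℝ} (ha : a ≤ 1) (hb : b ≤ 1) :
    IntervalIntegrable (fun t : ℝ => Real.log (1 - t) / t) volume a b := by
  -- away from `1` the integrand is a.e. the divided difference of `log (1 - t)`, which is continuous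
  have near_zero : ∀ c d : ℝ, c < 1 → d < 1 →
      IntervalIntegrable (fun t : ℝ => Real.log (1 - t) / t) volume c d := by
    intro c d hc hd
    have hcont : ContinuousOn (dslope (fun t : ℝ => Real.log (1 - t)) 0) (uIcc c d) :=
      continuousOn_dslope_log_one_sub.mono fun t ht =>
        lt_of_le_of_lt ht.2 (max_lt hc hd)
    refine hcont.intervalIntegrable.congr_ae ?_
    refine ae_restrict_of_ae ?_
    have : ∀ᵐ t : ℝ, t ≠ 0 := by simp [ae_iff]
    filter_upwards [this] with t ht
    exact dslope_log_one_sub_of_ne ht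
  have near_one :
      IntervalIntegrable (fun t : ℝ => Real.log (1 - t) / t) volume (1 / 2) 1 := by
    have h1 : IntervalIntegrable (fun t : ℝ => Real.log (1 - t)) volume (1 / 2) 1 := by
      have := (intervalIntegral.intervalIntegrable_log' (a := 1 / 2) (b := 0)).comp_sub_left 1
      norm_num at this ⊢
      exact this
    simp_rw [div_eq_mul_inv]
    refine h1.mul_continuousOn (ContinuousOn.inv₀ continuousOn_id fun t ht => ?_)
    rw [uIcc_of_le (by norm_num)] at ht
    have := ht.1
    linarith
  have to_one : ∀ c : ℝ, c ≤ 1 →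
      IntervalIntegrable (fun t : ℝ => Real.log (1 - t) / t) volume c 1 := by
    intro c hc
    rcases hc.lt_or_eq with h | rfl
    · exact (near_zero c (1 / 2) h (by norm_num)).trans near_one
    · exact IntervalIntegrable.refl
  exact (to_one a ha).trans (to_one b hb).symm

theorem continuousOn_dilog : ContinuousOn dilog (Set.Iic 1) := by
  intro x hx
  have hx' : x ≤ 1 := hx
  set m := min x 0 - 1
  have hm : m < x ∧ m < 0 := ⟨by have := min_le_left x 0; grind, by have := min_le_right x 0; grind⟩
  have hc : ContinuousOn dilog (Set.Icc m 1) := by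
    have h0 : (0 : ℝ) ∈ Set.uIcc m 1 := by
      rw [Set.uIcc_of_le (by linarith)]; constructor <;> linarith
    have := intervalIntegral.continuousOn_primitive_interval'
      (intervalIntegrable_log_one_sub_div (a := m) (b := 1) (by linarith) le_rfl) h0
    rw [Set.uIcc_of_le (by linarith)] at this
    exact this.neg
  refine (hc x ⟨hm.1.le, hx'⟩).mono_of_mem_nhdsWithin ?_
  rw [← Set.Ici_inter_Iic]
  exact Filter.inter_mem (mem_nhdsWithin_of_mem_nhds (Ici_mem_nhds hm.1)) self_mem_nhdsWithin

theorem hasDerivAt_dilog {x : ℝ} (h0 : x ≠ 0) (h1 : x < 1) :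
    HasDerivAt dilog (-(Real.log (1 - x) / x)) x := by
  have h1' : 1 - x ≠ 0 := by linarith
  refine HasDerivAt.neg (intervalIntegral.integral_hasDerivAt_right
    (intervalIntegrable_log_one_sub_div zero_le_one h1.le) ?_ ?_)
  · exact (Measurable.stronglyMeasurable (by fun_prop)).stronglyMeasurableAtFilter
  · fun_prop (disch := assumption)

open MeasureTheory Set in
/-- Expand `-log (1 - t) / t = ∑ tⁿ / (n + 1)` and integrate termwise to get `ζ(2)`. -/
theorem dilog_one : dilog 1 = Real.pi ^ 2 / 6 := by
  have hint : ∀ n : ℕ, ∫ t in Ioc (0 : ℝ) 1, t ^ n / ((n : ℝ) + 1) = 1 / ((n + 1 : ℕ) : ℝ) ^ 2 := by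
    intro n
    rw [← intervalIntegral.integral_of_le zero_le_one, intervalIntegral.integral_div, integral_pow]
    have : (n : ℝ) + 1 ≠ 0 := by positivity
    simp; field_simp
  have hzeta : HasSum (fun n : ℕ => 1 / ((n + 1 : ℕ) : ℝ) ^ 2) (Real.pi ^ 2 / 6) := by
    have := (hasSum_nat_add_iff' (f := fun n : ℕ => 1 / (n : ℝ) ^ 2) 1).2 hasSum_zeta_two
    simpa using this
  have hF : HasSum (fun n : ℕ => ∫ t in Ioc (0 : ℝ) 1, t ^ n / ((n : ℝ) + 1))
      (∫ t in Ioc (0 : ℝ) 1, ∑' n : ℕ, t ^ n / ((n : ℝ) + 1)) := by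
    refine hasSum_integral_of_summable_integral_norm (fun n => ?_) ?_
    · exact (Continuous.integrableOn_Ioc (by fun_prop))
    · refine hzeta.summable.congr fun n => ?_
      rw [← hint n]
      refine setIntegral_congr_fun measurableSet_Ioc fun t ht => ?_
      have := ht.1.le
      rw [Real.norm_of_nonneg (by positivity)]
  have hL : dilog 1 = ∫ t in Ioc (0 : ℝ) 1, ∑' n : ℕ, t ^ n / ((n : ℝ) + 1) := by
    rw [dilog, ← intervalIntegral.integral_neg, intervalIntegral.integral_of_le zero_le_one,
      integral_Ioc_eq_integral_Ioo, integral_Ioc_eq_integral_Ioo]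
    refine setIntegral_congr_fun measurableSet_Ioo fun t ht => ?_
    have ht0 : t ≠ 0 := ht.1.ne'
    have hs := (Real.hasSum_pow_div_log_of_abs_lt_one
      (abs_lt.2 ⟨by linarith [ht.1], ht.2⟩)).div_const t
    have : HasSum (fun n : ℕ => t ^ n / ((n : ℝ) + 1)) (-Real.log (1 - t) / t) := by
      have he : (fun n : ℕ => t ^ n / ((n : ℝ) + 1)) =
          fun n : ℕ => t ^ (n + 1) / ((n : ℝ) + 1) / t := by
        funext n
        rw [pow_succ]; field_simp
      rw [he]
      exact hs
    rw [this.tsum_eq, neg_div]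
  rw [hL]
  simp_rw [hint] at hF
  exact hF.unique hzeta

theorem continuous_log_mul_log_one_sub :
    Continuous fun x : ℝ => Real.log x * Real.log (1 - x) := by
  have hlt : ∀ x : ℝ, x < 1 → ContinuousAt (fun x : ℝ => Real.log x * Real.log (1 - x)) x := by
    intro x hx
    -- `log x` is unbounded at `0` but `x log x` is continuous there
    have h : (fun x : ℝ => Real.log x * Real.log (1 - x)) =
        fun x => (x * Real.log x) * dslope (fun t : ℝ => Real.log (1 - t)) 0 x := by
      funext t
      rcases eq_or_ne t 0 with rfl | ht
      · simp
      · rw [dslope_log_one_sub_of_ne ht]; field_simp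
    rw [h]
    exact Real.continuous_mul_log.continuousAt.mul
      (continuousOn_dslope_log_one_sub.continuousAt (Iio_mem_nhds hx))
  refine continuous_iff_continuousAt.2 fun x => ?_
  rcases lt_or_ge x 1 with hx | hx
  · exact hlt x hx
  · have h := (hlt (1 - x) (by linarith))
    have h2 : ContinuousAt (fun y : ℝ => 1 - y) x := by fun_prop
    have := ContinuousAt.comp (f := fun y : ℝ => 1 - y) h h2
    refine this.congr (Filter.Eventually.of_forall fun y => ?_)
    simp [mul_comm]

theorem rogersL_eq (x : ℝ) :
    rogersL x = dilog x + 1 / 2 * (Real.log x * Real.log (1 - x)) := by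
  rw [rogersL, Real.log_abs, mul_assoc]

theorem continuousOn_rogersL : ContinuousOn rogersL (Set.Iic 1) := by
  have h := continuousOn_dilog.add
    ((continuous_log_mul_log_one_sub.const_mul (1 / 2 : ℝ)).continuousOn (s := Set.Iic 1))
  exact h.congr fun x _ => rogersL_eq x

theorem rogersL_zero : rogersL 0 = 0 := by simp [rogersL, dilog]

theorem rogersL_one : rogersL 1 = Real.pi ^ 2 / 6 := by simp [rogersL, dilog_one]

/-- The differential `dL(u) = ½ (log |u| dlog (1 - u) - log (1 - u) dlog |u|)`, pulled back along a
function `u`. -/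
theorem HasDerivAt.rogersL {u : ℝ → ℝ} {u' x : ℝ} (hu : HasDerivAt u u' x) (h0 : u x ≠ 0)
    (h1 : u x < 1) :
    HasDerivAt (fun y => rogersL (u y))
      (-(1 / 2) * (Real.log (u x) * (u' / (1 - u x)) + Real.log (1 - u x) * (u' / u x))) x := by
  have h1' : 1 - u x ≠ 0 := by linarith
  have h := ((hasDerivAt_dilog h0 h1).comp x hu).add
    (((hu.log h0).mul ((hu.const_sub 1).log h1')).const_mul (1 / 2 : ℝ))
  refine (h.congr_deriv ?_).congr_of_eventuallyEq (Filter.Eventually.of_forall fun y => ?_)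
  · field_simp; ring
  · simp [rogersL_eq]

theorem eq_of_hasDerivAt_zero {f : ℝ → ℝ} {a b : ℝ} (hab : a ≤ b)
    (hc : ContinuousOn f (Set.Icc a b))
    (hd : ∀ x ∈ Set.Ioo a b, HasDerivAt f 0 x) : f a = f b := by
  rcases hab.eq_or_lt with rfl | hab
  · rfl
  · obtain ⟨c, -, h⟩ := exists_hasDerivAt_eq_slope f (fun _ => 0) hab hc hd
    have : b - a ≠ 0 := by linarith
    field_simp at h
    linarith

/-- Euler's reflection formula. -/
theorem rogersL_add_rogersL_one_sub {x : ℝ} (h0 : 0 ≤ x) (h1 : x ≤ 1) :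
    rogersL x + rogersL (1 - x) = Real.pi ^ 2 / 6 := by
  have h := eq_of_hasDerivAt_zero (f := fun y => rogersL y + rogersL (1 - y)) h0 ?_ ?_
  · simp only [rogersL_zero, sub_zero, rogersL_one, zero_add] at h
    exact h.symm
  · refine (continuousOn_rogersL.mono fun y hy => hy.2.trans h1).add
      (continuousOn_rogersL.comp (by fun_prop) fun y hy => ?_)
    have := hy.1
    simp only [Set.mem_Iic]; linarith
  · intro y hy
    have hy0 : 0 < y := hy.1
    have hy1 : y < 1 := hy.2.trans_le h1
    refine (((hasDerivAt_id y).rogersL hy0.ne' hy1).add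
      (((hasDerivAt_id y).const_sub 1).rogersL (by simp only [id]; linarith)
        (by simp only [id]; linarith))).congr_deriv ?_
    have : 1 - y ≠ 0 := by linarith
    simp only [id, sub_sub_cancel]
    field_simp
    ring

/-- Landen's transformation, which carries the negative axis to `(0, 1)`. -/
theorem rogersL_of_neg {x : ℝ} (hx : x < 0) : rogersL x = -rogersL (x / (x - 1)) := by
  have h := eq_of_hasDerivAt_zero (f := fun y => rogersL y + rogersL (y / (y - 1))) hx.le ?_ ?_
  · simp only [rogersL_zero, zero_div, add_zero] at h
    linarith
  · refine (continuousOn_rogersL.mono fun y hy => hy.2.trans zero_le_one).add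
      (continuousOn_rogersL.comp (ContinuousOn.div (by fun_prop) (by fun_prop) ?_) fun y hy => ?_)
    · intro y hy; have := hy.2; linarith
    · have := hy.2
      rw [Set.mem_Iic, div_le_one_of_neg (by linarith)]; linarith
  · intro y hy
    have hy0 : y < 0 := hy.2
    have hy0' := hy0.ne
    have hy1 : y - 1 ≠ 0 := by linarith
    have hy1' : 1 - y ≠ 0 := by linarith
    have hd : HasDerivAt (fun y : ℝ => y / (y - 1)) ((1 * (y - 1) - y * 1) / (y - 1) ^ 2) y :=
      (hasDerivAt_id y).div ((hasDerivAt_id y).sub_const 1) hy1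
    refine (((hasDerivAt_id y).rogersL hy0.ne (by simp only [id]; linarith)).add
      (hd.rogersL (div_ne_zero hy0.ne hy1) ?_)).congr_deriv ?_
    · rw [div_lt_one_of_neg (by linarith)]; linarith
    · have e : 1 - y / (y - 1) = (1 - y)⁻¹ := by
        rw [← neg_sub y 1, inv_neg]; field_simp; ring
      have e2 : Real.log (y / (y - 1)) = Real.log y - Real.log (1 - y) := by
        rw [Real.log_div hy0.ne hy1, ← Real.log_neg_eq_log (y - 1), neg_sub]
      simp only [id]
      rw [e, e2, Real.log_inv]
      rw [← neg_sub 1 y]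
      field_simp
      ring

/-- Abel's five-term relation. -/
theorem rogersL_add_rogersL {x y : ℝ} (hx0 : 0 < x) (hx1 : x < 1) (hy0 : 0 < y) (hy1 : y < 1) :
    rogersL x + rogersL y = rogersL (x * y) + rogersL (x * (1 - y) / (1 - x * y)) +
      rogersL (y * (1 - x) / (1 - x * y)) := by
  have hD : ∀ z, 0 ≤ z → z ≤ x → 0 < 1 - z * y := fun z h0 h1 => by nlinarith
  have h := eq_of_hasDerivAt_zero (f := fun z => rogersL z - rogersL (z * y) -
      rogersL (z * (1 - y) / (1 - z * y)) - rogersL (y * (1 - z) / (1 - z * y))) hx0.le ?_ ?_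
  · simp only [rogersL_zero, zero_mul, sub_zero, mul_one, div_one] at h
    linarith
  · have hc : ∀ u : ℝ → ℝ, ContinuousOn u (Set.Icc 0 x) → (∀ z ∈ Set.Icc 0 x, u z ≤ 1) →
        ContinuousOn (fun z => rogersL (u z)) (Set.Icc 0 x) := fun u hu h1 =>
      continuousOn_rogersL.comp hu h1
    refine (((hc _ continuousOn_id ?_).sub (hc _ (by fun_prop) ?_)).sub
      (hc _ (ContinuousOn.div (by fun_prop) (by fun_prop) fun z hz => (hD z hz.1 hz.2).ne') ?_)).sub
      (hc _ (ContinuousOn.div (by fun_prop) (by fun_prop) fun z hz => (hD z hz.1 hz.2).ne') ?_)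
    · intro z hz; exact hz.2.trans hx1.le
    · intro z hz; have := hD z hz.1 hz.2; linarith
    · intro z hz
      rw [Pi.div_apply, div_le_one (hD z hz.1 hz.2)]; linarith [hz.2]
    · intro z hz
      rw [div_le_one (hD z hz.1 hz.2)]; linarith [hz.2]
  · intro z hz
    have hz0 : 0 < z := hz.1
    have hz1 : 0 < 1 - z := by linarith [hz.2]
    have hy1' : 0 < 1 - y := by linarith
    have hDz := hD z hz.1.le hz.2.le
    have d1 := hasDerivAt_id z
    have d2 : HasDerivAt (fun z => z * y) y z := by simpa using d1.mul_const y
    have dD : HasDerivAt (fun z => 1 - z * y) (-y) z := d2.const_sub 1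
    have d3 : HasDerivAt (fun z => z * (1 - y) / (1 - z * y))
        ((1 * (1 - y) * (1 - z * y) - z * (1 - y) * (-y)) / (1 - z * y) ^ 2) z :=
      (d1.mul_const (1 - y)).div dD hDz.ne'
    have d4 : HasDerivAt (fun z => y * (1 - z) / (1 - z * y))
        ((y * (-1) * (1 - z * y) - y * (1 - z) * (-y)) / (1 - z * y) ^ 2) z :=
      ((d1.const_sub 1).const_mul y).div dD hDz.ne'
    have hDz' : 1 - y * z ≠ 0 := by rw [mul_comm y z]; exact hDz.ne'
    have e3 : 1 - z * (1 - y) / (1 - z * y) = (1 - z) / (1 - z * y) := by field_simp; ring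
    have e4 : 1 - y * (1 - z) / (1 - z * y) = (1 - y) / (1 - z * y) := by
      rw [eq_div_iff hDz.ne', sub_mul, div_mul_cancel₀ _ hDz.ne']; ring
    refine ((((d1.rogersL hz0.ne' (by simp only [id]; linarith)).sub
      (d2.rogersL (by positivity) (by linarith))).sub
      (d3.rogersL (by positivity) ?_)).sub (d4.rogersL (by positivity) ?_)).congr_deriv ?_
    · rw [← sub_pos, e3]; positivity
    · rw [← sub_pos, e4]; positivity
    · simp only [id]
      rw [e3, e4, Real.log_div (mul_pos hz0 hy1').ne' hDz.ne',
        Real.log_div (mul_pos hy0 hz1).ne' hDz.ne',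
        Real.log_div hz1.ne' hDz.ne', Real.log_div hy1'.ne' hDz.ne',
        Real.log_mul hz0.ne' hy0.ne', Real.log_mul hz0.ne' hy1'.ne',
        Real.log_mul hy0.ne' hz1.ne']
      field_simp
      ring

/-! ### The relation for the regular polygon -/

open Real in
/-- The pentagon relation: Abel's relation for the cross-ratios of an ideal pentagon two of whose
sides subtend the angle `2θ`. -/
theorem rogersL_sin_pentagon {θ β γ : ℝ} (hθ : 0 < θ) (hβ : 0 < β) (hγ : 0 < γ)
    (h : β + γ + 2 * θ < π) :
    rogersL (sin θ * sin (β + γ + θ) / (sin (γ + θ) * sin (β + θ))) +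
      rogersL (sin θ * sin (β + θ) / (sin (β + γ + θ) * sin (γ + θ))) =
    rogersL (sin θ ^ 2 / sin (γ + θ) ^ 2) +
      rogersL (sin θ * sin (β + γ + 2 * θ) / (sin (β + θ) * sin (γ + 2 * θ))) +
      rogersL (sin θ * sin β / (sin (β + γ + θ) * sin (γ + 2 * θ))) := by
  have pos : ∀ t, 0 < t → t < π → 0 < sin t := fun t => sin_pos_of_pos_of_lt_pi
  have p1 := pos θ hθ (by linarith)
  have p2 := pos (β + γ + θ) (by linarith) (by linarith)
  have p3 := pos (γ + θ) (by linarith) (by linarith)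
  have p4 := pos (β + θ) (by linarith) (by linarith)
  have p5 := pos (β + γ + 2 * θ) (by linarith) (by linarith)
  have p6 := pos (γ + 2 * θ) (by linarith) (by linarith)
  have p7 := pos β hβ (by linarith)
  have p8 := pos γ hγ (by linarith)
  have cs : ∀ t : ℝ, cos t ^ 2 = 1 - sin t ^ 2 := cos_sq'
  -- Ptolemy's relations between the chords of the pentagon
  have q1 : sin (γ + θ) * sin (β + θ) - sin θ * sin (β + γ + θ) = sin γ * sin β := by
    simp only [sin_add, cos_add]; ring_nf; simp only [cs]; ring
  have q2 : sin (β + γ + θ) * sin (γ + θ) - sin θ * sin (β + θ) =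
      sin (β + γ + 2 * θ) * sin γ := by
    simp only [sin_add, cos_add, two_mul]; ring_nf; simp only [cs]; ring_nf
  have q3 : sin (γ + θ) ^ 2 - sin θ ^ 2 = sin γ * sin (γ + 2 * θ) := by
    simp only [sin_add, cos_add, two_mul]; ring_nf; simp only [cs]; ring_nf
  set x := sin θ * sin (β + γ + θ) / (sin (γ + θ) * sin (β + θ)) with hx
  set y := sin θ * sin (β + θ) / (sin (β + γ + θ) * sin (γ + θ)) with hy
  have hx1 : 1 - x = sin γ * sin β / (sin (γ + θ) * sin (β + θ)) := by
    rw [hx, ← q1]; field_simp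
  have hy1 : 1 - y = sin (β + γ + 2 * θ) * sin γ / (sin (β + γ + θ) * sin (γ + θ)) := by
    rw [hy, ← q2]; field_simp
  have hxy : x * y = sin θ ^ 2 / sin (γ + θ) ^ 2 := by rw [hx, hy]; field_simp
  have hxy1 : 1 - x * y = sin γ * sin (γ + 2 * θ) / sin (γ + θ) ^ 2 := by
    rw [hxy, ← q3]; field_simp
  have ineq1 : x < 1 := sub_pos.1 (by rw [hx1]; positivity)
  have ineq2 : y < 1 := sub_pos.1 (by rw [hy1]; positivity)
  rw [rogersL_add_rogersL (by positivity) ineq1 (by positivity) ineq2, hx1, hy1, hxy1, hxy, hx, hy]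
  congr 2
  · congr 1; field_simp
  · field_simp

/-- The relation for the fan polygon with vertices `0, …, m + 2` on a circle, consecutive ones at
angle `2θ`. The first sum runs over the pairs of short sides, grouped by their separation, the
second over the pairs made of a short side and the long closing side. Attaching one more vertex
adds `π² / 6`, because the pentagon relations telescope. -/
theorem rogersL_fan_sum {θ : ℝ} (hθ : 0 < θ) (m : ℕ) (hm : (m + 2) * θ < Real.pi) :
    ∑ r ∈ Finset.range m, ((m : ℝ) - r) *
        rogersL (Real.sin θ ^ 2 / Real.sin ((r + 2) * θ) ^ 2) +
      ∑ i ∈ Finset.range m, rogersL (Real.sin θ * Real.sin ((m + 2) * θ) /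
        (Real.sin ((i + 2) * θ) * Real.sin ((m + 1 - i) * θ))) = m * (Real.pi ^ 2 / 6) := by
  induction m with
  | zero => simp
  | succ m ih =>
    push_cast at hm
    have ih := ih (by nlinarith)
    set f : ℝ → ℝ := fun r => rogersL (Real.sin θ ^ 2 / Real.sin (r * θ) ^ 2) with hf
    set G : ℕ → ℝ := fun i => rogersL (Real.sin θ * Real.sin ((i + 1) * θ) /
      (Real.sin ((m + 2) * θ) * Real.sin ((m + 2 - i) * θ))) with hG
    have pent : ∀ i ∈ Finset.range m,
        rogersL (Real.sin θ * Real.sin ((m + 2) * θ) /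
          (Real.sin ((i + 2) * θ) * Real.sin ((m + 1 - i) * θ))) + (G (i + 1) - G i) =
        f (((m - 1 - i : ℕ) : ℝ) + 2) +
        rogersL (Real.sin θ * Real.sin (((m + 1 : ℕ) + 2) * θ) /
          (Real.sin ((i + 2) * θ) * Real.sin (((m + 1 : ℕ) + 1 - i) * θ))) := by
      intro i hi
      have him : i + 1 ≤ m := Finset.mem_range.1 hi
      have him' : (i : ℝ) + 1 ≤ m := by exact_mod_cast him
      have h := rogersL_sin_pentagon (β := (i + 1) * θ) (γ := (m - i) * θ) hθ (by positivity)
        (mul_pos (by linarith) hθ) (by nlinarith)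
      have e : ((m - 1 - i : ℕ) : ℝ) = m - 1 - i := by
        rw [Nat.cast_sub (by omega), Nat.cast_sub (by omega)]; simp
      have a1 : ((i : ℝ) + 1) * θ + (m - i) * θ + θ = (m + 2) * θ := by ring
      have a2 : ((m : ℝ) - i) * θ + θ = (m + 1 - i) * θ := by ring
      have a3 : ((i : ℝ) + 1) * θ + θ = (i + 2) * θ := by ring
      have a4 : ((i : ℝ) + 1) * θ + (m - i) * θ + 2 * θ = (m + 1 + 2) * θ := by ring
      have a5 : ((m : ℝ) - i) * θ + 2 * θ = (m + 1 + 1 - i) * θ := by ring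
      rw [a1, a2, a3, a4, a5] at h
      simp only [hf, hG, e]
      push_cast
      rw [show (m : ℝ) - 1 - i + 2 = m + 1 - i by ring, show (i : ℝ) + 1 + 1 = i + 2 by ring,
        show (m : ℝ) + 2 - (i + 1) = m + 1 - i by ring, show (m : ℝ) + 2 - i = m + 1 + 1 - i by ring,
        mul_comm (Real.sin ((i + 2) * θ)) (Real.sin ((m + 1 - i) * θ))]
      linarith
    -- the differences `G (i + 1) - G i` telescope to `G m - G 0`
    have tele := Finset.sum_congr rfl pent
    rw [Finset.sum_add_distrib, Finset.sum_add_distrib, Finset.sum_range_sub,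
      Finset.sum_range_reflect (fun r : ℕ => f ((r : ℝ) + 2)) m] at tele
    -- complementary cross-ratios of the quadrilateral `v₀, v_{m+1}, v_{m+2}, v_{m+3}`
    have last : rogersL (Real.sin θ * Real.sin (((m + 1 : ℕ) + 2) * θ) /
          (Real.sin ((m + 2) * θ) * Real.sin (((m + 1 : ℕ) + 1 - m) * θ))) + G m
          = Real.pi ^ 2 / 6 := by
      have pos : ∀ t : ℝ, 0 < t → t ≤ m + 3 → 0 < Real.sin (t * θ) := fun t h0 h1 =>
        Real.sin_pos_of_pos_of_lt_pi (by positivity) (by nlinarith)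
      have p1 := pos 1 one_pos (by linarith)
      have p2 := pos 2 two_pos (by linarith)
      have p3 := pos (m + 1) (by positivity) (by linarith)
      have p4 := pos (m + 2) (by positivity) (by linarith)
      have p5 := pos (m + 3) (by positivity) (by linarith)
      rw [one_mul] at p1
      have q : Real.sin θ * Real.sin ((m + 3) * θ) + Real.sin θ * Real.sin ((m + 1) * θ) =
          Real.sin ((m + 2) * θ) * Real.sin (2 * θ) := by
        rw [show ((m : ℝ) + 3) * θ = (m + 2) * θ + θ by ring,
          show ((m : ℝ) + 1) * θ = (m + 2) * θ - θ by ring, Real.sin_add, Real.sin_sub,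
          Real.sin_two_mul]
        ring
      have hsub : Real.sin θ * Real.sin ((m + 1) * θ) /
          (Real.sin ((m + 2) * θ) * Real.sin (2 * θ)) =
          1 - Real.sin θ * Real.sin ((m + 3) * θ) /
            (Real.sin ((m + 2) * θ) * Real.sin (2 * θ)) := by
        rw [eq_sub_iff_add_eq, ← add_div, add_comm, q, div_self (by positivity)]
      simp only [hG]
      push_cast
      rw [show (m : ℝ) + 1 + 1 - m = 2 by ring, show (m : ℝ) + 2 - m = 2 by ring,
        show (m : ℝ) + 1 + 2 = m + 3 by ring, hsub]
      refine rogersL_add_rogersL_one_sub (by positivity) ?_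
      rw [← sub_nonneg, ← hsub]; positivity
    have first : G 0 = f (m + 2) := by
      simp only [hG, hf]; norm_num [sq]
    rw [Finset.sum_range_succ (fun i : ℕ => rogersL (Real.sin θ * Real.sin (((m + 1 : ℕ) + 2) * θ) /
          (Real.sin ((i + 2) * θ) * Real.sin (((m + 1 : ℕ) + 1 - i) * θ))))]
    have hsum : ∑ r ∈ Finset.range (m + 1), (((m + 1 : ℕ) : ℝ) - r) * f (r + 2) =
        ∑ r ∈ Finset.range m, ((m : ℝ) - r) * f (r + 2) + ∑ r ∈ Finset.range m, f (r + 2) +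
          f (m + 2) := by
      rw [Finset.sum_range_succ, ← Finset.sum_add_distrib]
      congr 1
      · refine Finset.sum_congr rfl fun r _ => ?_
        push_cast; ring
      · push_cast; ring
    rw [hsum]
    push_cast at *
    linarith

/-- A sum over pairs of disjoint sides that depends only on the separation `r`, which runs over
`2, …, n - 2` and is attained by `n - r` pairs. -/
theorem sum_disjointSidePairs (f : ℕ → ℝ) (n : ℕ) :
    ∑ p ∈ disjointSidePairs n, f (p.2 - p.1) =
      ∑ r ∈ Finset.Icc 2 (n - 2), ((n - r : ℕ) : ℝ) * f r := by
  have hmap : ∀ p ∈ disjointSidePairs n, p.2 - p.1 ∈ Finset.Icc 2 (n - 2) := by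
    intro p hp
    simp only [disjointSidePairs, Finset.mem_filter, Finset.mem_product, Finset.mem_range] at hp
    rw [Finset.mem_Icc]; omega
  rw [← Finset.sum_fiberwise_of_maps_to hmap]
  refine Finset.sum_congr rfl fun r hr => ?_
  rw [Finset.mem_Icc] at hr
  have hcard : ((disjointSidePairs n).filter fun p => p.2 - p.1 = r).card = n - r := by
    rw [← Finset.card_range (n - r)]
    refine (Finset.card_bij (fun i _ => (i, i + r)) ?_ ?_ ?_).symm
    · intro i hi
      simp only [disjointSidePairs, Finset.mem_filter, Finset.mem_product, Finset.mem_range] at hi ⊢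
      omega
    · intro i _ j _ h
      exact (Prod.mk.inj h).1
    · intro p hp
      simp only [disjointSidePairs, Finset.mem_filter, Finset.mem_product, Finset.mem_range] at hp
      refine ⟨p.1, Finset.mem_range.2 (by omega), Prod.ext rfl ?_⟩
      simp only; omega
  rw [← hcard, ← nsmul_eq_mul, ← Finset.sum_const]
  refine Finset.sum_congr rfl fun p hp => ?_
  rw [(Finset.mem_filter.1 hp).2]

theorem sin_natCast_sub_mul_pi_div {n r : ℕ} (hn : n ≠ 0) (hr : r ≤ n) :
    Real.sin (((n - r : ℕ) : ℝ) * Real.pi / n) = Real.sin (r * Real.pi / n) := by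
  have hn' : (n : ℝ) ≠ 0 := by exact_mod_cast hn
  rw [Nat.cast_sub hr, ← Real.sin_pi_sub]
  congr 1; field_simp; ring

/-- The pairs of sides, counted by their separation, satisfy the polygon relation. -/
theorem sum_sub_mul_rogersL {n : ℕ} (hn : 3 ≤ n) :
    ∑ r ∈ Finset.Icc 2 (n - 2), ((n - r : ℕ) : ℝ) *
      rogersL (Real.sin (Real.pi / n) ^ 2 / Real.sin (r * Real.pi / n) ^ 2) =
      ((n : ℝ) - 3) * Real.pi ^ 2 / 6 := by
  -- for `n = m + 3` the closing side of the fan subtends the same angle as the short sides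
  obtain ⟨m, rfl⟩ := Nat.exists_eq_add_of_le' hn
  have hpos : (0 : ℝ) < (m + 3 : ℕ) := by positivity
  set θ := Real.pi / (m + 3 : ℕ) with hθ
  have hπ := Real.pi_pos
  have hθ0 : 0 < θ := by positivity
  have hmul : (((m : ℝ) + 3)) * θ = Real.pi := by rw [hθ]; push_cast; field_simp
  have h := rogersL_fan_sum hθ0 m (by nlinarith)
  have hrefl : ∀ t : ℝ, Real.sin ((m + 3 - t) * θ) = Real.sin (t * θ) := fun t => by
    rw [sub_mul, hmul, Real.sin_pi_sub]
  rw [← Finset.sum_add_distrib] at h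
  have hI : Finset.Icc 2 (m + 3 - 2) = Finset.Ico (0 + 2) (m + 2) := by ext; simp; omega
  rw [hI, ← Finset.sum_Ico_add', ← Finset.range_eq_Ico]
  push_cast
  rw [show ((m : ℝ) + 3 - 3) * Real.pi ^ 2 / 6 = m * (Real.pi ^ 2 / 6) by ring, ← h]
  refine Finset.sum_congr rfl fun r hr => ?_
  have hr' := Finset.mem_range.1 hr
  rw [Nat.cast_sub (by omega)]
  have e1 := hrefl 1
  have e2 := hrefl (r + 2)
  rw [show (m : ℝ) + 3 - 1 = m + 2 by ring, one_mul] at e1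
  rw [show (m : ℝ) + 3 - (r + 2) = m + 1 - r by ring] at e2
  rw [e1, e2, mul_div_assoc]
  push_cast at hθ ⊢
  rw [← hθ, ← sq, ← sq]
  ring

/-- Grouping the separations `r` and `n - r`, which have the same parameter. -/
theorem sum_sub_mul_eq_of_symm {n : ℕ} (hn : 3 ≤ n) (f : ℕ → ℝ)
    (hf : ∀ r, r ≤ n → f (n - r) = f r) :
    ∑ r ∈ Finset.Icc 2 (n - 2), ((n - r : ℕ) : ℝ) * f r =
      ∑ r ∈ Finset.Icc 2 ((n + 1) / 2 - 1), (n : ℝ) * f r +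
        (if Even n then (1 : ℝ) else 0) * ((n : ℝ) / 2) * f (n / 2) := by
  -- split the range at its midpoint and reflect the upper half
  have key : ∀ g : ℕ → ℝ, ∑ r ∈ Finset.Icc 2 (n - 2), g r =
      ∑ r ∈ Finset.Icc 2 ((n + 1) / 2 - 1), (g r + g (n - r)) +
        if Even n ∧ 4 ≤ n then g (n / 2) else 0 := by
    intro g
    have hr : ∑ r ∈ Finset.Icc 2 ((n + 1) / 2 - 1), g (n - r) =
        ∑ r ∈ Finset.Icc (n / 2 + 1) (n - 2), g r := by
      refine Finset.sum_bij (fun r _ => n - r) ?_ ?_ ?_ ?_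
      · intro r h; rw [Finset.mem_Icc] at h ⊢; omega
      · intro r h s h'; rw [Finset.mem_Icc] at h h'; omega
      · intro s h; rw [Finset.mem_Icc] at h
        exact ⟨n - s, by rw [Finset.mem_Icc]; omega, by omega⟩
      · intro r _; rfl
    rw [Finset.sum_add_distrib, hr]
    have hd : Disjoint (Finset.Icc 2 ((n + 1) / 2 - 1)) (Finset.Icc (n / 2 + 1) (n - 2)) := by
      rw [Finset.disjoint_left]; intro a; rw [Finset.mem_Icc, Finset.mem_Icc]; omega
    rw [← Finset.sum_union hd]
    split_ifs with h
    · obtain ⟨⟨k, hk⟩, h4⟩ := h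
      have hnot : n / 2 ∉ Finset.Icc 2 ((n + 1) / 2 - 1) ∪ Finset.Icc (n / 2 + 1) (n - 2) := by
        rw [Finset.mem_union, Finset.mem_Icc, Finset.mem_Icc]; omega
      rw [add_comm, ← Finset.sum_insert hnot]
      refine Finset.sum_congr ?_ fun _ _ => rfl
      ext a; simp only [Finset.mem_Icc, Finset.mem_insert, Finset.mem_union]; omega
    · rw [add_zero]
      have h' : n % 2 = 1 := by
        rcases Nat.even_or_odd n with he | ho
        · exact absurd ⟨he, by obtain ⟨k, hk⟩ := he; omega⟩ h
        · exact Nat.odd_iff.1 ho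
      refine Finset.sum_congr ?_ fun _ _ => rfl
      ext a; simp only [Finset.mem_Icc, Finset.mem_union]; omega
  rw [key]
  congr 1
  · refine Finset.sum_congr rfl fun r hr => ?_
    rw [Finset.mem_Icc] at hr
    have hrn : r ≤ n := by omega
    rw [hf r hrn, Nat.sub_sub_self hrn, Nat.cast_sub hrn]; ring
  · by_cases he : Even n
    · obtain ⟨k, hk⟩ := he
      have h2 : n / 2 = k := by omega
      have he : Even n := ⟨k, hk⟩
      rw [if_pos ⟨he, by omega⟩, if_pos he, h2, Nat.cast_sub (by omega), hk]
      push_cast; ring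
    · simp [he]

theorem natCeil_natCast_div_two (n : ℕ) : ⌈(n : ℝ) / 2⌉₊ = (n + 1) / 2 := by
  refine le_antisymm (Nat.ceil_le.2 ?_) ?_
  · rw [div_le_iff₀ two_pos]
    have : n ≤ (n + 1) / 2 * 2 := by omega
    exact_mod_cast this
  · have h := Nat.le_ceil ((n : ℝ) / 2)
    rw [div_le_iff₀ two_pos] at h
    have : n ≤ ⌈(n : ℝ) / 2⌉₊ * 2 := by exact_mod_cast h
    omega

theorem regularPolygonSum_eq_sum_sub_mul {n : ℕ} (hn : 3 ≤ n) :
    regularPolygonSum n = ∑ r ∈ Finset.Icc 2 (n - 2), ((n - r : ℕ) : ℝ) *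
      rogersL (Real.sin (Real.pi / n) ^ 2 / Real.sin (r * Real.pi / n) ^ 2) := by
  rw [sum_sub_mul_eq_of_symm hn
    (fun r => rogersL (Real.sin (Real.pi / n) ^ 2 / Real.sin (r * Real.pi / n) ^ 2))
    fun r hr => by simp only [sin_natCast_sub_mul_pi_div (by omega : n ≠ 0) hr],
    regularPolygonSum, natCeil_natCast_div_two]
  congr 1
  by_cases he : Even n
  · have h2 : ((n / 2 : ℕ) : ℝ) = n / 2 := Nat.cast_div he.two_dvd (by norm_num)
    have hn' : (n : ℝ) ≠ 0 := by positivity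
    have : ((n / 2 : ℕ) : ℝ) * Real.pi / n = Real.pi / 2 := by rw [h2]; field_simp
    simp only [this, Real.sin_pi_div_two, one_pow, div_one]
  · simp [he]

theorem regularPolygonSum_eq {n : ℕ} (hn : 3 ≤ n) :
    regularPolygonSum n = ((n : ℝ) - 3) * Real.pi ^ 2 / 6 :=
  (regularPolygonSum_eq_sum_sub_mul hn).trans (sum_sub_mul_rogersL hn)

/-! ### Distances between the sides -/

/-- The geodesic whose ideal endpoints have arguments `φ - θ` and `φ + θ`, parametrized by the signed
hyperbolic arc length `s` measured from its midpoint. -/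
noncomputable def geodesicPoint (θ φ s : ℝ) : ℂ :=
  Complex.exp (φ * Complex.I) *
    ((Real.cos θ * Real.cosh s : ℝ) + (Real.sin θ * Real.sinh s : ℝ) * Complex.I) /
      ((Real.cosh s + Real.sin θ : ℝ) : ℂ)

theorem geodesicPoint_re (θ φ s : ℝ) : (geodesicPoint θ φ s).re =
    (Real.cos φ * (Real.cos θ * Real.cosh s) - Real.sin φ * (Real.sin θ * Real.sinh s)) /
      (Real.cosh s + Real.sin θ) := by
  rw [geodesicPoint, Complex.div_ofReal_re, Complex.exp_mul_I, ← Complex.ofReal_cos,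
    ← Complex.ofReal_sin]
  simp [-Complex.ofReal_cos, -Complex.ofReal_sin, -Complex.ofReal_sinh, -Complex.ofReal_cosh]

theorem geodesicPoint_im (θ φ s : ℝ) : (geodesicPoint θ φ s).im =
    (Real.cos φ * (Real.sin θ * Real.sinh s) + Real.sin φ * (Real.cos θ * Real.cosh s)) /
      (Real.cosh s + Real.sin θ) := by
  rw [geodesicPoint, Complex.div_ofReal_im, Complex.exp_mul_I, ← Complex.ofReal_cos,
    ← Complex.ofReal_sin]
  simp [-Complex.ofReal_cos, -Complex.ofReal_sin, -Complex.ofReal_sinh, -Complex.ofReal_cosh]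

theorem one_sub_norm_sq_geodesicPoint {θ : ℝ} (hθ : 0 < Real.sin θ) (φ s : ℝ) :
    1 - ‖geodesicPoint θ φ s‖ ^ 2 = 2 * Real.sin θ / (Real.cosh s + Real.sin θ) := by
  have hD : 0 < Real.cosh s + Real.sin θ := by have := Real.cosh_pos s; linarith
  rw [Complex.sq_norm, Complex.normSq_apply, geodesicPoint_re, geodesicPoint_im]
  field_simp
  ring_nf
  simp only [Real.cosh_sq, Real.cos_sq']
  ring

/-- The Möbius map `z ↦ (z - a) / (z - b)` takes `geodesicPoint θ φ s` to `-i exp (s - iθ)`. -/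
theorem geodesicPoint_sub {θ : ℝ} (hθ : 0 < Real.sin θ) (φ s : ℝ) :
    geodesicPoint θ φ s - Complex.exp ((φ - θ : ℝ) * Complex.I) =
      -(Complex.I * Real.exp s * Complex.exp ((-θ : ℝ) * Complex.I)) *
        (geodesicPoint θ φ s - Complex.exp ((φ + θ : ℝ) * Complex.I)) := by
  have hD : ((Real.cosh s + Real.sin θ : ℝ) : ℂ) ≠ 0 := by
    have := Real.cosh_pos s
    exact_mod_cast (by positivity : Real.cosh s + Real.sin θ ≠ 0)
  have hU : Complex.exp ((φ - θ : ℝ) * Complex.I) =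
      Complex.exp (φ * Complex.I) * Complex.exp ((-θ : ℝ) * Complex.I) := by
    rw [← Complex.exp_add]; congr 1; push_cast; ring
  have hU' : Complex.exp ((φ + θ : ℝ) * Complex.I) =
      Complex.exp (φ * Complex.I) * Complex.exp (θ * Complex.I) := by
    rw [← Complex.exp_add]; congr 1; push_cast; ring
  have hWV : Complex.exp (θ * Complex.I) * Complex.exp ((-θ : ℝ) * Complex.I) = 1 := by
    rw [← Complex.exp_add, ← Complex.exp_zero]; congr 1; push_cast; ring
  have hEQ : Complex.exp s * Complex.exp (-s) = 1 := by
    rw [← Complex.exp_add, ← Complex.exp_zero]; congr 1; ring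
  have hc : (Real.cos θ : ℂ) =
      (Complex.exp (θ * Complex.I) + Complex.exp ((-θ : ℝ) * Complex.I)) / 2 := by
    rw [Complex.ofReal_cos, Complex.cos]; push_cast; rfl
  have hs : (Real.sin θ : ℂ) =
      (Complex.exp ((-θ : ℝ) * Complex.I) - Complex.exp (θ * Complex.I)) * Complex.I / 2 := by
    rw [Complex.ofReal_sin, Complex.sin]; push_cast; rfl
  have hch : (Real.cosh s : ℂ) = (Complex.exp s + Complex.exp (-s)) / 2 := by
    rw [Complex.ofReal_cosh, Complex.cosh]
  have hsh : (Real.sinh s : ℂ) = (Complex.exp s - Complex.exp (-s)) / 2 := by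
    rw [Complex.ofReal_sinh, Complex.sinh]
  rw [geodesicPoint, hU, hU']
  rw [Complex.ofReal_add] at hD
  rw [Complex.ofReal_add, Complex.ofReal_mul, Complex.ofReal_mul, Complex.ofReal_exp]
  generalize Complex.exp (θ * Complex.I) = W at *
  generalize Complex.exp ((-θ : ℝ) * Complex.I) = V at *
  generalize Complex.exp (s : ℂ) = E at *
  generalize Complex.exp (-s : ℂ) = Q at *
  generalize Complex.exp (φ * Complex.I) = U at *
  generalize (Real.cosh s : ℂ) = Ch at *
  generalize (Real.sinh s : ℂ) = Sh at *
  generalize (Real.sin θ : ℂ) = S at *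
  generalize (Real.cos θ : ℂ) = C at *
  have hpoly : (C * Ch + S * Sh * Complex.I) - V * (Ch + S) =
      -(Complex.I * E * V) * ((C * Ch + S * Sh * Complex.I) - W * (Ch + S)) := by
    rw [hc, hs, hch, hsh]
    linear_combination (W - V) / 2 * (-(Complex.I * V) * hEQ + Complex.I ^ 2 * E * hWV +
      E * Complex.I_sq) + (V - W) * (E - Q) * (1 + Complex.I * V * E) / 4 * Complex.I_sq
  field_simp
  linear_combination U * hpoly

/-- The arc-length parameter of a point is `s = ½ log t`, for the `t` in the definition of
`diskGeodesic`. -/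
theorem diskGeodesic_eq_range {θ : ℝ} (hθ : 0 < Real.sin θ) (φ : ℝ) :
    diskGeodesic (Complex.exp ((φ - θ : ℝ) * Complex.I)) (Complex.exp ((φ + θ : ℝ) * Complex.I)) =
      Set.range (geodesicPoint θ φ) := by
  have hU : Complex.exp ((φ - θ : ℝ) * Complex.I) =
      Complex.exp (φ * Complex.I) * Complex.exp ((-θ : ℝ) * Complex.I) := by
    rw [← Complex.exp_add]; congr 1; push_cast; ring
  have hU' : Complex.exp ((φ + θ : ℝ) * Complex.I) =
      Complex.exp (φ * Complex.I) * Complex.exp (θ * Complex.I) := by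
    rw [← Complex.exp_add]; congr 1; push_cast; ring
  have hWV : Complex.exp (θ * Complex.I) * Complex.exp ((-θ : ℝ) * Complex.I) = 1 := by
    rw [← Complex.exp_add, ← Complex.exp_zero]; congr 1; push_cast; ring
  have hV : Complex.exp ((-θ : ℝ) * Complex.I) = Real.cos θ - Real.sin θ * Complex.I := by
    rw [Complex.exp_mul_I, ← Complex.ofReal_cos, ← Complex.ofReal_sin, Real.cos_neg, Real.sin_neg]
    push_cast; ring
  have hcs := Real.sin_sq_add_cos_sq θ
  ext z
  constructor
  · rintro ⟨hz, t, ht, h⟩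
    refine ⟨Real.log t / 2, ?_⟩
    set s := Real.log t / 2 with hs
    have hE : (t : ℂ) = (Real.exp s : ℂ) ^ 2 := by
      rw [← Complex.ofReal_pow, ← Real.exp_nat_mul, hs]
      push_cast
      rw [mul_div_cancel₀ _ two_ne_zero, ← Complex.ofReal_exp, Real.exp_log ht]
    have hγ := geodesicPoint_sub hθ φ s
    have hEpos := Real.exp_pos s
    set E := Real.exp s
    set a := Complex.exp ((φ - θ : ℝ) * Complex.I)
    set b := Complex.exp ((φ + θ : ℝ) * Complex.I)
    set V := Complex.exp ((-θ : ℝ) * Complex.I)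
    set W := Complex.exp (θ * Complex.I)
    set U := Complex.exp (φ * Complex.I) with hUdef
    have hU0 : U ≠ 0 := Complex.exp_ne_zero _
    -- the defining equation is a difference of squares, as `b = a V⁻²`
    have hprod : (z - a + Complex.I * E * V * (z - b)) *
        (z - a - Complex.I * E * V * (z - b)) = 0 := by
      have h1 : U * ((z - a) ^ 2 + (E : ℂ) ^ 2 * V ^ 2 * (z - b) ^ 2) = 0 := by
        rw [hE, hU', hU] at h
        rw [hU', hU]
        linear_combination V * h - U * (z - U * V) ^ 2 * hWV
      have h2 := (mul_eq_zero.1 h1).resolve_left hU0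
      linear_combination h2 - (E : ℂ) ^ 2 * V ^ 2 * (z - b) ^ 2 * Complex.I_sq
    rcases mul_eq_zero.1 hprod with h1 | h1
    · have hne : 1 + Complex.I * E * V ≠ 0 := by
        rw [hV]
        intro h0
        have := congrArg Complex.re h0
        simp [-Complex.ofReal_cos, -Complex.ofReal_sin] at this
        nlinarith
      refine mul_left_cancel₀ hne ?_
      linear_combination hγ - h1
    · -- the other square root gives the inverse point, outside the disk
      exfalso
      have hz1 : z * (1 - Complex.I * E * V) = U * (V - Complex.I * E) := by
        rw [hU, hU'] at h1
        linear_combination h1 - Complex.I * E * U * hWV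
      have hn := congrArg Complex.normSq hz1
      rw [map_mul, map_mul, Complex.normSq_eq_norm_sq U, hUdef, Complex.norm_exp_ofReal_mul_I, hV,
        Complex.normSq_apply (1 - _), Complex.normSq_apply (_ - _), Complex.normSq_eq_norm_sq] at hn
      simp [-Complex.ofReal_cos, -Complex.ofReal_sin] at hn
      have hz2 : ‖z‖ ^ 2 < 1 := by nlinarith [norm_nonneg z]
      have hp := mul_pos hEpos hθ
      have hnn : 0 ≤ (1 - E * Real.sin θ) * (1 - E * Real.sin θ) +
        E * Real.cos θ * (E * Real.cos θ) :=
        add_nonneg (mul_self_nonneg _) (mul_self_nonneg _)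
      nlinarith
  · rintro ⟨s, rfl⟩
    refine ⟨?_, Real.exp s ^ 2, by positivity, ?_⟩
    · have h := one_sub_norm_sq_geodesicPoint hθ φ s
      have := Real.cosh_pos s
      have : 0 < 1 - ‖geodesicPoint θ φ s‖ ^ 2 := by rw [h]; positivity
      nlinarith [norm_nonneg (geodesicPoint θ φ s)]
    · rw [geodesicPoint_sub hθ φ s, hU]
      nth_rw 1 [hU']
      push_cast at hWV ⊢
      linear_combination Complex.exp (φ * Complex.I) * Complex.exp s ^ 2 *
        Complex.exp (-θ * Complex.I) * (geodesicPoint θ φ s -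
          Complex.exp ((φ + θ) * Complex.I)) ^ 2 *
        (Complex.I ^ 2 * hWV + Complex.I_sq)

/-- The quantity `sinh² (d / 2)` for two points on geodesics with the same aperture `2θ`, whose
midpoints are at angle `2ρ` from each other. It depends on the two arc lengths `s`, `s'` through
`s + s'` and `s - s'` separately. -/
theorem norm_sq_geodesicPoint_sub {θ : ℝ} (hθ : 0 < Real.sin θ) (φ ρ s s' : ℝ) :
    ‖geodesicPoint θ φ s - geodesicPoint θ (φ + 2 * ρ) s'‖ ^ 2 /
      ((1 - ‖geodesicPoint θ φ s‖ ^ 2) * (1 - ‖geodesicPoint θ (φ + 2 * ρ) s'‖ ^ 2)) =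
    (Real.sin ρ ^ 2 * Real.cosh (s + s') +
      ((Real.sin θ ^ 2 + Real.sin ρ ^ 2 - 2 * Real.sin θ ^ 2 * Real.sin ρ ^ 2) *
        Real.cosh (s - s') - 2 * Real.sin θ * Real.cos θ * Real.sin ρ * Real.cos ρ *
        Real.sinh (s - s')) - Real.sin θ ^ 2) / (2 * Real.sin θ ^ 2) := by
  have hD : 0 < Real.cosh s + Real.sin θ := by have := Real.cosh_pos s; linarith
  have hD' : 0 < Real.cosh s' + Real.sin θ := by have := Real.cosh_pos s'; linarith
  have key : ‖geodesicPoint θ φ s - geodesicPoint θ (φ + 2 * ρ) s'‖ ^ 2 =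
      (1 - (1 - ‖geodesicPoint θ φ s‖ ^ 2)) + (1 - (1 - ‖geodesicPoint θ (φ + 2 * ρ) s'‖ ^ 2)) -
        2 * ((geodesicPoint θ φ s).re * (geodesicPoint θ (φ + 2 * ρ) s').re +
          (geodesicPoint θ φ s).im * (geodesicPoint θ (φ + 2 * ρ) s').im) := by
    simp only [Complex.sq_norm, Complex.normSq_apply, Complex.sub_re, Complex.sub_im]
    ring
  have inner : (geodesicPoint θ φ s).re * (geodesicPoint θ (φ + 2 * ρ) s').re +
      (geodesicPoint θ φ s).im * (geodesicPoint θ (φ + 2 * ρ) s').im =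
      (Real.cos (2 * ρ) * (Real.cos θ ^ 2 * (Real.cosh s * Real.cosh s') +
        Real.sin θ ^ 2 * (Real.sinh s * Real.sinh s')) +
        Real.sin (2 * ρ) * (Real.cos θ * Real.sin θ) *
          (Real.sinh s * Real.cosh s' - Real.cosh s * Real.sinh s')) /
        ((Real.cosh s + Real.sin θ) * (Real.cosh s' + Real.sin θ)) := by
    simp only [geodesicPoint_re, geodesicPoint_im, Real.cos_add, Real.sin_add]
    field_simp
    linear_combination (Real.cos (2 * ρ) * (Real.cos θ ^ 2 * (Real.cosh s * Real.cosh s') +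
        Real.sin θ ^ 2 * (Real.sinh s * Real.sinh s')) +
        Real.sin (2 * ρ) * (Real.cos θ * Real.sin θ) *
          (Real.sinh s * Real.cosh s' - Real.cosh s * Real.sinh s')) * Real.sin_sq_add_cos_sq φ
  rw [key, inner, one_sub_norm_sq_geodesicPoint hθ, one_sub_norm_sq_geodesicPoint hθ,
    Real.cosh_add, Real.cosh_sub, Real.sinh_sub, Real.cos_two_mul', Real.sin_two_mul,
    Real.cos_sq' θ, Real.cos_sq' ρ]
  field_simp
  ring

/-- If `|sin θ| < |sin ρ|`, the terms of `norm_sq_geodesicPoint_sub` in `p = s - s'` combine into one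
shifted hyperbolic cosine. -/
theorem exists_cosh_eq {θ ρ : ℝ} (h : Real.sin θ ^ 2 < Real.sin ρ ^ 2) : ∃ p₀ : ℝ, ∀ p : ℝ,
    (Real.sin θ ^ 2 + Real.sin ρ ^ 2 - 2 * Real.sin θ ^ 2 * Real.sin ρ ^ 2) * Real.cosh p -
      2 * Real.sin θ * Real.cos θ * Real.sin ρ * Real.cos ρ * Real.sinh p =
    (Real.sin ρ ^ 2 - Real.sin θ ^ 2) * Real.cosh (p - p₀) := by
  set m := Real.sin ρ ^ 2 - Real.sin θ ^ 2 with hm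
  have hm0 : 0 < m := sub_pos.2 h
  set B := Real.sin θ ^ 2 + Real.sin ρ ^ 2 - 2 * Real.sin θ ^ 2 * Real.sin ρ ^ 2 with hB
  set C := 2 * Real.sin θ * Real.cos θ * Real.sin ρ * Real.cos ρ with hC
  -- hence `(B, C) = m (cosh p₀, sinh p₀)` for some `p₀`
  have hBC : B ^ 2 = m ^ 2 + C ^ 2 := by
    rw [hB, hC, hm]; ring_nf; simp only [Real.cos_sq']; ring
  have hB0 : 0 ≤ B := by
    have h1 := Real.sin_sq_le_one θ
    have h2 := Real.sin_sq_le_one ρ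
    rw [hB]
    nlinarith [mul_nonneg (sq_nonneg (Real.sin θ)) (sub_nonneg.2 h2),
      mul_nonneg (sq_nonneg (Real.sin ρ)) (sub_nonneg.2 h1)]
  refine ⟨Real.arsinh (C / m), fun p => ?_⟩
  have hc : Real.cosh (Real.arsinh (C / m)) = B / m := by
    rw [Real.cosh_arsinh, Real.sqrt_eq_iff_mul_self_eq (by positivity) (by positivity)]
    field_simp
    linarith
  rw [Real.cosh_sub, hc, Real.sinh_arsinh]
  field_simp

theorem diskDist_eq_two_mul_arsinh_sqrt (z w : ℂ) :
    diskDist z w =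
      2 * Real.arsinh (√(‖z - w‖ ^ 2 / ((1 - ‖z‖ ^ 2) * (1 - ‖w‖ ^ 2)))) := by
  rw [diskDist, Real.sqrt_div (sq_nonneg _), Real.sqrt_sq (norm_nonneg _)]

/-- The distance between the two geodesics is attained, where both hyperbolic cosines equal `1`. -/
theorem isLeast_diskDist_geodesicPoint {θ ρ : ℝ} (hθ : 0 < Real.sin θ)
    (h : Real.sin θ ^ 2 < Real.sin ρ ^ 2) (φ : ℝ) :
    IsLeast {d | ∃ z ∈ Set.range (geodesicPoint θ φ),
        ∃ w ∈ Set.range (geodesicPoint θ (φ + 2 * ρ)), d = diskDist z w}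
      (2 * Real.arsinh (√((Real.sin ρ ^ 2 - Real.sin θ ^ 2) / Real.sin θ ^ 2))) := by
  obtain ⟨p₀, hp⟩ := exists_cosh_eq h
  constructor
  · refine ⟨_, ⟨p₀ / 2, rfl⟩, _, ⟨-(p₀ / 2), rfl⟩, ?_⟩
    rw [diskDist_eq_two_mul_arsinh_sqrt, norm_sq_geodesicPoint_sub hθ, hp]
    congr 3
    rw [add_neg_cancel, show p₀ / 2 - -(p₀ / 2) - p₀ = 0 by ring, Real.cosh_zero]
    field_simp
    ring
  · rintro d ⟨_, ⟨s, rfl⟩, _, ⟨s', rfl⟩, rfl⟩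
    rw [diskDist_eq_two_mul_arsinh_sqrt, norm_sq_geodesicPoint_sub hθ, hp]
    refine mul_le_mul_of_nonneg_left (Real.arsinh_le_arsinh.2 (Real.sqrt_le_sqrt ?_)) zero_le_two
    rw [div_le_div_iff₀ (by positivity) (by positivity)]
    have h1 := Real.one_le_cosh (s + s')
    have h2 := Real.one_le_cosh (s - s' - p₀)
    have hm : 0 ≤ Real.sin ρ ^ 2 - Real.sin θ ^ 2 := (sub_pos.2 h).le
    have hS : 0 < Real.sin θ ^ 2 := by positivity
    have e1 := mul_le_mul_of_nonneg_left h1 (sq_nonneg (Real.sin ρ))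
    have e2 := mul_le_mul_of_nonneg_left h2 hm
    nlinarith

theorem cosh_half_two_mul_arsinh_sqrt {x : ℝ} (hx : 0 ≤ x) :
    Real.cosh (2 * Real.arsinh √x / 2) ^ 2 = 1 + x := by
  rw [mul_div_cancel_left₀ _ two_ne_zero, Real.cosh_arsinh, Real.sq_sqrt (by positivity),
    Real.sq_sqrt hx]

theorem vertex_eq (n k : ℕ) :
    vertex n k = Complex.exp ((2 * (k * (Real.pi / n)) : ℝ) * Complex.I) := by
  rw [vertex]; congr 1; push_cast; ring

theorem side_eq_range {n : ℕ} (hn : 0 < Real.sin (Real.pi / n)) (k : ℕ) :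
    side n k = Set.range (geodesicPoint (Real.pi / n) ((2 * k + 1) * (Real.pi / n))) := by
  rw [← diskGeodesic_eq_range hn, side, vertex_eq, vertex_eq]
  congr 4 <;> push_cast <;> ring

theorem sin_pi_div_pos {n : ℕ} (hn : 2 ≤ n) : 0 < Real.sin (Real.pi / n) := by
  have hn' : (2 : ℝ) ≤ n := by exact_mod_cast hn
  have := Real.pi_pos
  refine Real.sin_pos_of_pos_of_lt_pi (by positivity) ?_
  rw [div_lt_iff₀ (by positivity)]; nlinarith

theorem sin_pi_div_lt {n r : ℕ} (h2 : 2 ≤ r) (hr : r + 2 ≤ n) :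
    Real.sin (Real.pi / n) < Real.sin (r * (Real.pi / n)) := by
  have hn' : (r : ℝ) + 2 ≤ n := by exact_mod_cast hr
  have h2' : (2 : ℝ) ≤ r := by exact_mod_cast h2
  have hn0 : (0 : ℝ) < n := by linarith
  have hπ := Real.pi_pos
  have hθ : 0 < Real.pi / n := by positivity
  have hmul : (n : ℝ) * (Real.pi / n) = Real.pi := by field_simp
  rw [← sub_pos, Real.sin_sub_sin]
  have h1 : 0 < Real.sin ((r * (Real.pi / n) - Real.pi / n) / 2) :=
    Real.sin_pos_of_pos_of_lt_pi (by nlinarith) (by nlinarith)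
  have h3 : 0 < Real.cos ((r * (Real.pi / n) + Real.pi / n) / 2) :=
    Real.cos_pos_of_mem_Ioo ⟨by nlinarith, by nlinarith⟩
  positivity

theorem exp_sub_exp (x y : ℝ) :
    Complex.exp ((2 * x : ℝ) * Complex.I) - Complex.exp ((2 * y : ℝ) * Complex.I) =
      2 * Complex.I * (Real.sin (x - y) : ℝ) * Complex.exp ((x + y : ℝ) * Complex.I) := by
  rw [Complex.ofReal_sin, Complex.sin,
    show ((2 * x : ℝ) : ℂ) * Complex.I = ((x - y : ℝ) : ℂ) * Complex.I +
      ((x + y : ℝ) : ℂ) * Complex.I by push_cast; ring,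
    show ((2 * y : ℝ) : ℂ) * Complex.I = -((x - y : ℝ) : ℂ) * Complex.I +
      ((x + y : ℝ) : ℂ) * Complex.I by push_cast; ring, Complex.exp_add, Complex.exp_add]
  linear_combination (Complex.exp (((x - y : ℝ) : ℂ) * Complex.I) -
    Complex.exp (-((x - y : ℝ) : ℂ) * Complex.I)) *
      Complex.exp (((x + y : ℝ) : ℂ) * Complex.I) * Complex.I_sq

/-- The cross-ratio of four points of the circle in terms of the sines of their half-angles. -/
theorem crossRatio_vertex {n i r : ℕ} (hr : Real.sin (r * (Real.pi / n)) ≠ 0) :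
    crossRatio (vertex n i) (vertex n (i + 1)) (vertex n (i + r)) (vertex n (i + r + 1)) =
      ((Real.sin (Real.pi / n) ^ 2 / Real.sin (r * (Real.pi / n)) ^ 2 : ℝ) : ℂ) := by
  simp only [crossRatio, vertex_eq, exp_sub_exp]
  generalize Real.pi / (n : ℝ) = θ at *
  push_cast [-Complex.ofReal_sin]
  rw [show (i : ℝ) * θ - (i + 1) * θ = -θ by ring,
    show ((i : ℝ) + r + 1) * θ - (i + r) * θ = θ by ring,
    show (i : ℝ) * θ - (i + r) * θ = -(r * θ) by ring,
    show ((i : ℝ) + r + 1) * θ - (i + 1) * θ = r * θ by ring, Real.sin_neg, Real.sin_neg]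
  have hr' : ((Real.sin (r * θ) : ℝ) : ℂ) ≠ 0 := by exact_mod_cast hr
  have hexp : Complex.exp (((i : ℂ) * θ + (i + 1) * θ) * Complex.I) *
        Complex.exp ((((i : ℂ) + r + 1) * θ + (i + r) * θ) * Complex.I) =
      Complex.exp (((i : ℂ) * θ + (i + r) * θ) * Complex.I) *
        Complex.exp ((((i : ℂ) + r + 1) * θ + (i + 1) * θ) * Complex.I) := by
    rw [← Complex.exp_add, ← Complex.exp_add]; congr 1; ring
  rw [div_eq_div_iff]
  · push_cast [-Complex.ofReal_sin]
    linear_combination (-(2 * Complex.I) ^ 2 * (Real.sin θ : ℂ) ^ 2 * (Real.sin (r * θ) : ℂ) ^ 2) *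
      hexp
  · have := Complex.exp_ne_zero
    simp only [Complex.ofReal_neg]
    simp [this, hr', -Complex.ofReal_sin]
  · exact pow_ne_zero 2 hr'

theorem isLeast_sideDistances {n i r : ℕ} (h2 : 2 ≤ r) (hr : r + 2 ≤ n) :
    IsLeast (sideDistances n i (i + r))
      (2 * Real.arsinh (√((Real.sin (r * (Real.pi / n)) ^ 2 - Real.sin (Real.pi / n) ^ 2) /
        Real.sin (Real.pi / n) ^ 2))) := by
  have hθ := sin_pi_div_pos (n := n) (by omega)
  have hlt := pow_lt_pow_left₀ (sin_pi_div_lt h2 hr) hθ.le two_ne_zero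
  have h := isLeast_diskDist_geodesicPoint hθ hlt ((2 * i + 1) * (Real.pi / n))
  rw [sideDistances, side_eq_range hθ, side_eq_range hθ]
  convert h using 7
  push_cast; ring_nf

/-! ### Special values -/

theorem rogersL_inv_goldenRatio_sq : rogersL ((Real.goldenRatio ^ 2)⁻¹) = Real.pi ^ 2 / 15 := by
  have h := regularPolygonSum_eq (n := 5) (by norm_num)
  rw [regularPolygonSum, natCeil_natCast_div_two, if_neg (by decide)] at h
  norm_num at h
  have hs : Real.sin (Real.pi / 5) ≠ 0 := by
    have := (sin_pi_div_pos (n := 5) (by norm_num)).ne'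
    exact_mod_cast this
  have e : Real.sin (Real.pi / 5) ^ 2 / Real.sin (2 * Real.pi / 5) ^ 2 =
      (Real.goldenRatio ^ 2)⁻¹ := by
    rw [mul_div_assoc, Real.sin_two_mul, Real.cos_pi_div_five, Real.goldenRatio]
    field_simp; ring
  rw [e] at h
  linarith

theorem rogersL_hexagon :
    6 * rogersL (1 / 3) + 3 * rogersL (1 / 4) = Real.pi ^ 2 / 2 := by
  have h := regularPolygonSum_eq (n := 6) (by norm_num)
  rw [regularPolygonSum, natCeil_natCast_div_two, if_pos (by decide)] at h
  norm_num [Real.sin_pi_div_six] at h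
  rw [show 2 * Real.pi / 6 = Real.pi / 3 by ring, Real.sin_pi_div_three, div_pow,
    Real.sq_sqrt (by norm_num)] at h
  norm_num at h ⊢
  linarith

theorem mainTheorem4 :
    (∀ n : ℕ, 3 ≤ n →
      -- the orthospectrum of the regular ideal polygon, and its parameters `1 / cosh² (l / 2)`
      (∀ p ∈ disjointSidePairs n,
        0 < orthoLength n p.1 p.2 ∧
        IsLeast (sideDistances n p.1 p.2) (orthoLength n p.1 p.2) ∧
        crossRatio (vertex n p.1) (vertex n (p.1 + 1)) (vertex n p.2) (vertex n (p.2 + 1)) =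
          ((1 / Real.cosh (orthoLength n p.1 p.2 / 2) ^ 2 : ℝ) : ℂ) ∧
        1 / Real.cosh (orthoLength n p.1 p.2 / 2) ^ 2 =
          Real.sin (Real.pi / n) ^ 2 /
            Real.sin (((p.2 - p.1 : ℕ) : ℝ) * Real.pi / n) ^ 2) ∧
      -- the sum over the orthospectrum, written out
      (∑ p ∈ disjointSidePairs n,
          rogersL (1 / Real.cosh (orthoLength n p.1 p.2 / 2) ^ 2) = regularPolygonSum n) ∧
      -- the relation
      regularPolygonSum n = ((n : ℝ) - 3) * Real.pi ^ 2 / 6) ∧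
    -- golden-ratio values
    (rogersL (Real.goldenRatio⁻¹) = Real.pi ^ 2 / 10 ∧
      rogersL (1 - Real.goldenRatio⁻¹) = Real.pi ^ 2 / 15 ∧
      rogersL ((Real.goldenRatio ^ 2)⁻¹) = Real.pi ^ 2 / 15 ∧
      rogersL (-Real.goldenRatio⁻¹) = -(Real.pi ^ 2 / 15) ∧
      rogersL (-Real.goldenRatio) = -(Real.pi ^ 2 / 10)) ∧
    -- the hexagon relation
    6 * rogersL (1 / 3) + 3 * rogersL (1 / 4) = Real.pi ^ 2 / 2 := by
  refine ⟨fun n hn => ?_, ?_, rogersL_hexagon⟩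
  · have main : ∀ p ∈ disjointSidePairs n, 0 < orthoLength n p.1 p.2 ∧
        IsLeast (sideDistances n p.1 p.2) (orthoLength n p.1 p.2) ∧
        crossRatio (vertex n p.1) (vertex n (p.1 + 1)) (vertex n p.2) (vertex n (p.2 + 1)) =
          ((1 / Real.cosh (orthoLength n p.1 p.2 / 2) ^ 2 : ℝ) : ℂ) ∧
        1 / Real.cosh (orthoLength n p.1 p.2 / 2) ^ 2 =
          Real.sin (Real.pi / n) ^ 2 /
            Real.sin (((p.2 - p.1 : ℕ) : ℝ) * Real.pi / n) ^ 2 := by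
      rintro ⟨i, j⟩ hp
      simp only [disjointSidePairs, Finset.mem_filter, Finset.mem_product, Finset.mem_range] at hp
      obtain ⟨r, rfl⟩ := Nat.exists_eq_add_of_le (by omega : i ≤ j)
      have h2 : 2 ≤ r := by omega
      have hr : r + 2 ≤ n := by omega
      have hleast := isLeast_sideDistances (i := i) h2 hr
      have hθ := sin_pi_div_pos (n := n) (by omega)
      have hlt := sin_pi_div_lt h2 hr
      have hρ := hθ.trans hlt
      have hx : 0 < (Real.sin (r * (Real.pi / n)) ^ 2 - Real.sin (Real.pi / n) ^ 2) /
          Real.sin (Real.pi / n) ^ 2 :=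
        div_pos (sub_pos.2 (pow_lt_pow_left₀ hlt hθ.le two_ne_zero)) (by positivity)
      have hl : orthoLength n i (i + r) = _ := hleast.csInf_eq
      have hcosh : 1 / Real.cosh (orthoLength n i (i + r) / 2) ^ 2 =
          Real.sin (Real.pi / n) ^ 2 / Real.sin (r * (Real.pi / n)) ^ 2 := by
        rw [hl, cosh_half_two_mul_arsinh_sqrt hx.le]
        field_simp
        ring
      simp only [add_tsub_cancel_left]
      refine ⟨?_, hl ▸ hleast, ?_, ?_⟩
      · rw [hl]
        exact mul_pos two_pos (Real.arsinh_pos_iff.2 (Real.sqrt_pos.2 hx))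
      · rw [hcosh, crossRatio_vertex hρ.ne']
      · rw [hcosh, mul_div_assoc]
    refine ⟨main, ?_, regularPolygonSum_eq hn⟩
    rw [regularPolygonSum_eq_sum_sub_mul hn, ← sum_disjointSidePairs
      (fun r => rogersL (Real.sin (Real.pi / n) ^ 2 / Real.sin (r * Real.pi / n) ^ 2))]
    exact Finset.sum_congr rfl fun p hp => by rw [(main p hp).2.2.2]
  · have hφ := Real.goldenRatio_pos
    have hφ1 := Real.one_lt_goldenRatio
    have hsq := Real.goldenRatio_sq
    have h2 := rogersL_inv_goldenRatio_sq
    generalize Real.goldenRatio = φ at *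
    have hφ2 : φ + 1 ≠ 0 := by positivity
    have e : 1 - φ⁻¹ = (φ ^ 2)⁻¹ := by
      rw [hsq]; field_simp; linear_combination hsq
    have h1 : rogersL (φ⁻¹) = Real.pi ^ 2 / 10 := by
      have := rogersL_add_rogersL_one_sub (inv_nonneg.2 hφ.le) (inv_le_one_of_one_le₀ hφ1.le)
      rw [e] at this
      linarith
    refine ⟨h1, by rw [e, h2], h2, ?_, ?_⟩
    · rw [rogersL_of_neg (neg_lt_zero.2 (inv_pos.2 hφ)), ← h2]
      congr 2
      rw [hsq, div_eq_iff (by have := inv_pos.2 hφ; linarith)]; field_simp; ring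
    · rw [rogersL_of_neg (neg_lt_zero.2 hφ), ← h1]
      congr 2
      rw [div_eq_iff (by linarith)]
      field_simp; linarith
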